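/- Let $L$ be a CM-field with maximal totally real subfield $L_0$, and let $n=[L_0:\mathbb{Q}]$. Write $\mathcal{O}_K$ for the ring of integers of a number field $K$ and $\mathcal{U}_K=\mathcal{O}_K^\times$. Suppose that (a) $L_0$ has units of almost independent signs: every unit in $\mathcal{U}_{L_0}$ is negative under an even number of real embeddings of $L_0$ and, for every pair of distinct real embeddings of $L_0$, there is a unit in $\mathcal{U}_{L_0}$ that is negative under exactly the two embeddings in that pair; (b) the Hasse unit index $Q(L)=[\mathcal{U}_L:\mu_L\,\mathcal{U}_{L_0}]$ is equal to $2$, where $\mu_L$ is the group of roots of unity in $L$. Let $\Phi$ be a simple CM-type of $L$: a set of $n$ distinct embeddings $L\hookrightarrow\mathbb{C}$, no two of which are complex conjugate, which is not induced from a CM-type of a proper CM-subfield $K\subsetneq L$ (the CM-type of $L$ induced from a CM-type $\Psi$ of $K$ is $\{\phi : \phi|_K\in\Psi\}$). A complex torus $A=V/\Lambda$ is of type $(\mathcal{O}_L,\Phi)$ if there is an embedding $L\hookrightarrow \mathrm{End}(A)\otimes\mathbb{Q}$ for which the representation of $L$ on $V=\mathrm{Lie}(A)$ is isomorphic to $\bigoplus_{\phi\in\Phi}\phi$,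 and $\mathrm{End}(A)\simeq\mathcal{O}_L$ as rings. A polarization of $A$ is an alternating form $E:\Lambda\times\Lambda\to\mathbb{Z}$ such that $(x,y)\mapsto E_{\mathbb{R}}(x,\sqrt{-1}\,y)$ is symmetric and positive definite on $V$; it is principal if $E$ is unimodular. An isomorphism $(A,E)\to(A',E')$ of polarized abelian varieties is an isomorphism $A\to A'$ of complex tori under which $E'$ pulls back to $E$; two polarizations $E,E'$ of $A$ are isomorphic if $(A,E)\simeq(A,E')$. Then: 1. Every abelian variety over $\mathbb{C}$ of type $(\mathcal{O}_L,\Phi)$ has at most one principal polarization up to isomorphism. 2. If in addition $L$ has class number $1$, then any two principally polarized abelian varieties over $\mathbb{C}$ of type $(\mathcal{O}_L,\Phi)$ are isomorphic; that is, if such a principally polarized abelian variety exists, it is unique up to isomorphism. -/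

import Mathlib

universe u v w

/-- A number field `K` has units of almost independent signs if every unit of its ring of integers
is negative under an even number of real embeddings and, for every pair of real embeddings, there
is a unit which is negative under exactly the two embeddings in that pair. -/
def HasUnitsOfAlmostIndependentSigns (K : Type*) [Field K] [NumberField K] : Prop :=
  (∀ a : (NumberField.RingOfIntegers K)ˣ,
      Even (Nat.card {τ : K →+* ℝ // τ ((a : NumberField.RingOfIntegers K) : K) < 0})) ∧
    ∀ τ₁ τ₂ : K →+* ℝ, τ₁ ≠ τ₂ →
      ∃ a : (NumberField.RingOfIntegers K)ˣ,
        ∀ τ : K →+* ℝ, τ ((a : NumberField.RingOfIntegers K) : K) < 0 ↔ (τ = τ₁ ∨ τ = τ₂)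

/-- A CM-type of a CM-field `L` with `[L₀ : ℚ] = n`, where `L₀` is the maximal totally real
subfield: a set of `n` distinct embeddings `L → ℂ`, no two of which are complex conjugate. -/
def IsCMType {L : Type*} [Field L] [NumberField L] (Φ : Finset (L →+* ℂ)) : Prop :=
  Φ.card = Module.finrank ℚ (NumberField.maximalRealSubfield L) ∧
    ∀ φ ∈ Φ, NumberField.ComplexEmbedding.conjugate φ ∉ Φ

/-- A CM-type is simple if it is not induced from a CM-type `Ψ` of a proper CM-subfield `K`, where
the CM-type of `L` induced from `Ψ` consists of the embeddings whose restriction to `K` is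
in `Ψ`. -/
def IsSimpleCMType {L : Type*} [Field L] [NumberField L] (Φ : Finset (L →+* ℂ)) : Prop :=
  ∀ K : IntermediateField ℚ L, K ≠ ⊤ → NumberField.IsCMField K →
    ∀ Ψ : Finset (K →+* ℂ), IsCMType Ψ →
      ¬ ∀ φ : L →+* ℂ, φ ∈ Φ ↔ φ.comp (algebraMap K L) ∈ Ψ

/-- A complex torus `V / Λ`: a finite-dimensional complex vector space `V` with a full lattice `Λ`,
that is, the `ℤ`-span of a real basis of `V`. -/
structure ComplexTorus where
  V : Type u
  [addCommGroup : AddCommGroup V]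
  [module : Module ℂ V]
  [finiteDimensional : FiniteDimensional ℂ V]
  Λ : Submodule ℤ V
  isLattice : ∃ b : Module.Basis (Fin (Module.finrank ℝ V)) ℝ V,
    Submodule.span ℤ (Set.range b) = Λ

namespace ComplexTorus

attribute [instance] addCommGroup module finiteDimensional

/-- The endomorphism ring `End(A)` of the complex torus `A = V / Λ`: the complex linear
endomorphisms of `V` that map `Λ` into itself. -/
def endRing (A : ComplexTorus.{u}) : Subring (Module.End ℂ A.V) where
  carrier := {T | ∀ x ∈ A.Λ, T x ∈ A.Λ}
  mul_mem' := fun hS hT x hx => hS _ (hT x hx)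
  one_mem' := fun _ hx => hx
  add_mem' := fun hS hT x hx => A.Λ.add_mem (hS x hx) (hT x hx)
  zero_mem' := fun _ _ => A.Λ.zero_mem
  neg_mem' := fun hT x hx => A.Λ.neg_mem (hT x hx)

/-- The endomorphism algebra `End(A) ⊗ ℚ` of the complex torus `A = V / Λ`, as the ring of the
complex linear endomorphisms of `V` that have a nonzero integral multiple in `End(A)`. -/
def endAlgebra (A : ComplexTorus.{u}) : Subring (Module.End ℂ A.V) where
  carrier := {T | ∃ m : ℕ, m ≠ 0 ∧ m • T ∈ A.endRing}
  mul_mem' := by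
    rintro S T ⟨m, hm, hS⟩ ⟨k, hk, hT⟩
    refine ⟨m * k, mul_ne_zero hm hk, ?_⟩
    have h : (m * k) • (S * T) = (m • S) * (k • T) := by
      rw [smul_mul_smul_comm]
    rw [h]
    exact A.endRing.mul_mem hS hT
  one_mem' := ⟨1, one_ne_zero, by simp⟩
  add_mem' := by
    rintro S T ⟨m, hm, hS⟩ ⟨k, hk, hT⟩
    refine ⟨m * k, mul_ne_zero hm hk, ?_⟩
    have h : (m * k) • (S + T) = k • (m • S) + m • (k • T) := by
      rw [smul_add, smul_smul, smul_smul, mul_comm m k]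
    rw [h]
    exact A.endRing.add_mem (A.endRing.nsmul_mem hS k) (A.endRing.nsmul_mem hT m)
  zero_mem' := ⟨1, one_ne_zero, by simp⟩
  neg_mem' := by
    rintro T ⟨m, hm, hT⟩
    exact ⟨m, hm, by simpa using A.endRing.neg_mem hT⟩

/-- `A = V / Λ` is of type `(L, Φ)`: there is an embedding of `L` into `End(A) ⊗ ℚ` such that the
resulting complex representation of `L` on `V = Lie(A)` is the direct sum of the embeddings
`φ ∈ Φ`; in particular `dim A` is the cardinality of `Φ`. -/
def IsOfCMType (A : ComplexTorus.{u}) {L : Type*} [Field L] (Φ : Finset (L →+* ℂ)) : Prop :=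
  ∃ (ι : L →+* A.endAlgebra) (b : Module.Basis Φ ℂ A.V),
    ∀ (x : L) (φ : Φ), (ι x : Module.End ℂ A.V) (b φ) = (φ : L →+* ℂ) x • b φ

/-- `A` is of type `(𝓞_L, Φ)`: it is of type `(L, Φ)` and `End(A)` is isomorphic to the ring of
integers `𝓞_L`. -/
def IsOfIntegralCMType (A : ComplexTorus.{u}) {L : Type*} [Field L] (Φ : Finset (L →+* ℂ)) :
    Prop :=
  A.IsOfCMType Φ ∧ Nonempty (A.endRing ≃+* NumberField.RingOfIntegers L)

/-- A polarization of the complex torus `A = V / Λ`, given by its Riemann form: an alternating form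
with integral values on `Λ × Λ`, given here by its real bilinear extension `E` to `V`, such that
`(x, y) ↦ E(x, i y)` is symmetric and positive definite. -/
structure Polarization (A : ComplexTorus.{u}) where
  form : A.V →ₗ[ℝ] A.V →ₗ[ℝ] ℝ
  alternating : ∀ x, form x x = 0
  integral : ∀ x ∈ A.Λ, ∀ y ∈ A.Λ, ∃ k : ℤ, form x y = k
  symmetric : ∀ x y, form x (Complex.I • y) = form y (Complex.I • x)
  positive : ∀ x, x ≠ 0 → 0 < form x (Complex.I • x)

/-- A polarization is principal if `Λ` is self-dual for the Riemann form: every `x` in `V` that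
pairs integrally with `Λ` lies in `Λ`. -/
def Polarization.IsPrincipal {A : ComplexTorus.{u}} (E : A.Polarization) : Prop :=
  ∀ x, (∀ y ∈ A.Λ, ∃ k : ℤ, E.form x y = k) → x ∈ A.Λ

/-- The polarized complex tori `(A, E)` and `(B, F)` are isomorphic: there is an isomorphism of
complex tori `A → B` that pulls `F` back to `E`. For `A = B` this says that the polarizations `E`
and `F` of `A` are isomorphic. -/
def Polarization.IsIsomorphic {A : ComplexTorus.{u}} {B : ComplexTorus.{v}}
    (E : A.Polarization) (F : B.Polarization) : Prop :=
  ∃ T : A.V ≃ₗ[ℂ] B.V, (∀ x, T x ∈ B.Λ ↔ x ∈ A.Λ) ∧ ∀ x y, F.form (T x) (T y) = E.form x y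

end ComplexTorus

/-! By principality, two principal polarizations of `A` satisfy `E' x y = E (u x) y` for an
endomorphism `u`, which is invertible by symmetry of the roles, so a unit of `𝓞 L`. Since `E'` is
alternating and positive, `u` is real and positive under `Φ`, hence a totally positive unit of `L₀`.
The Rosati involution is complex conjugation, so `u = v * conj v` gives `E' x y = E (v x) (v y)`,
and the automorphism `v` identifies the two polarizations.

It remains to see that totally positive units are such norms. Let `U` be the units of `L₀`, `U⁺` the
totally positive ones and `N` the norms of units of `L`; then `U² ≤ N ≤ U⁺`. Almost independent
signs give `[U⁺ : U²] ≤ 2` (`relIndex_squares_ker_signature_le_two`), and `Q(L) = 2` gives `N ≠ U²`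
(`unitNorms_ne_squares`), so `N = U⁺`.

With class number one, `Λ` is free of rank one over `𝓞 L`, so all tori of the given type are
isomorphic, and uniqueness on a single torus applies after a pullback. -/

open NumberField

/-! ### Subgroups of sign vectors. -/

section SignVectors

variable {T : Type*} [Fintype T] [DecidableEq T]

/-- A subgroup of sign vectors containing all the vectors which are negative at exactly two places
has index at most two. -/
theorem Subgroup.index_signVectors_le_two [Nonempty T] (H : Subgroup (T → SignTypeˣ))
    (hH : ∀ i j : T, i ≠ j →
      (Pi.mulSingle i (-1) * Pi.mulSingle j (-1) : T → SignTypeˣ) ∈ H) :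
    H.index ≤ 2 := by
  obtain ⟨i₀⟩ := ‹Nonempty T›
  set g : T → SignTypeˣ := Pi.mulSingle i₀ (-1) with hg
  have hg2 : g ^ 2 = 1 := by
    rw [hg, ← Pi.mulSingle_pow]
    have : (-1 : SignTypeˣ) ^ 2 = 1 := by decide
    rw [this, Pi.mulSingle_one]
  -- The flip at `i` is the pair flip at `i, i₀` times `g`, so the single involution `g` generates
  -- everything together with `H`.
  have htop : Subgroup.zpowers g ⊔ H = ⊤ := by
    rw [Subgroup.eq_top_iff']
    intro f
    rw [← Finset.univ_prod_mulSingle f]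
    refine Subgroup.prod_mem _ fun i _ ↦ ?_
    have hcases : ∀ x : SignTypeˣ, x = 1 ∨ x = -1 := by decide
    rcases hcases (f i) with h | h
    · rw [h, Pi.mulSingle_one]
      exact one_mem _
    · rw [h]
      have hgm : g ∈ Subgroup.zpowers g ⊔ H :=
        Subgroup.mem_sup_left (Subgroup.mem_zpowers g)
      by_cases hi : i = i₀
      · rw [hi]
        exact hgm
      · have h1 := mul_mem (Subgroup.mem_sup_right (S := Subgroup.zpowers g) (hH i i₀ hi)) hgm
        rwa [mul_assoc, ← hg, ← pow_two, hg2, mul_one] at h1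
  have hrel : H.relIndex (Subgroup.zpowers g) = H.index := by
    rw [← Subgroup.relIndex_sup_right, htop, Subgroup.relIndex_top_right]
  have hdvd := Subgroup.relIndex_dvd_card H (Subgroup.zpowers g)
  rw [hrel, Nat.card_zpowers] at hdvd
  exact Nat.le_of_dvd two_pos (hdvd.trans (orderOf_dvd_of_pow_eq_one hg2))

end SignVectors

/-! ### Signatures and squares of units in a totally real field. -/

namespace NumberField.Units

variable (K : Type*) [Field K]

/-- The signs of a unit under the real embeddings. -/
noncomputable def signature : (𝓞 K)ˣ →* ((K →+* ℝ) → SignTypeˣ) :=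
  MonoidHom.pi fun τ ↦
    Units.map ((signHom : ℝ →*₀ SignType).toMonoidHom.comp
      ((τ.comp (algebraMap (𝓞 K) K) : 𝓞 K →+* ℝ) : 𝓞 K →* ℝ))

theorem coe_signature_apply (a : (𝓞 K)ˣ) (τ : K →+* ℝ) :
    (signature K a τ : SignType) = SignType.sign (τ (a : K)) := rfl

theorem mem_ker_signature (a : (𝓞 K)ˣ) :
    a ∈ (signature K).ker ↔ ∀ τ : K →+* ℝ, 0 < τ (a : K) := by
  simp only [MonoidHom.mem_ker, funext_iff, Units.ext_iff, coe_signature_apply, Pi.one_apply,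
    Units.val_one, sign_eq_one_iff]

theorem signature_apply_eq_neg_one (a : (𝓞 K)ˣ) (τ : K →+* ℝ) :
    signature K a τ = -1 ↔ τ (a : K) < 0 := by
  rw [Units.ext_iff, coe_signature_apply, Units.val_neg, Units.val_one, sign_eq_neg_one_iff]

theorem range_powMonoidHom_two_le_ker_signature :
    (powMonoidHom 2 : (𝓞 K)ˣ →* (𝓞 K)ˣ).range ≤ (signature K).ker := by
  rintro _ ⟨a, rfl⟩
  have h2 : ∀ s : SignTypeˣ, s ^ 2 = 1 := by decide
  rw [MonoidHom.mem_ker, powMonoidHom_apply, map_pow]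
  exact funext fun τ ↦ h2 _

variable [NumberField K]

theorem index_range_signature_le_two [Nonempty (K →+* ℝ)]
    (h : HasUnitsOfAlmostIndependentSigns K) :
    (signature K).range.index ≤ 2 := by
  classical
  refine Subgroup.index_signVectors_le_two _ fun i j hij ↦ ?_
  obtain ⟨a, ha⟩ := h.2 i j hij
  refine ⟨a, funext fun τ ↦ ?_⟩
  have hcases : ∀ x : SignTypeˣ, x = 1 ∨ x = -1 := by decide
  have haτ := (signature_apply_eq_neg_one K a τ).trans (ha τ)
  rw [Pi.mul_apply, Pi.mulSingle_apply, Pi.mulSingle_apply]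
  by_cases hi : τ = i
  · rw [if_pos hi, if_neg fun h ↦ hij (hi.symm.trans h), mul_one]
    exact haτ.2 (Or.inl hi)
  · by_cases hj : τ = j
    · rw [if_neg hi, if_pos hj, one_mul]
      exact haτ.2 (Or.inr hj)
    · rw [if_neg hi, if_neg hj, one_mul]
      exact (hcases _).resolve_right fun h' ↦ (haτ.1 h').elim hi hj

theorem eq_one_or_neg_one_of_mem_torsion (τ : K →+* ℝ) {ζ : (𝓞 K)ˣ} (hζ : ζ ∈ torsion K) :
    ζ = 1 ∨ ζ = -1 := by
  obtain ⟨m, hm, h⟩ := (isOfFinOrder_iff_pow_eq_one).1 ((CommGroup.mem_torsion ζ).1 hζ)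
  have h1 : τ (ζ : K) ^ m = 1 := by
    rw [← map_pow, ← coe_pow, h, coe_one, map_one]
  rcases pow_eq_one_iff_cases.1 h1 with h0 | h0 | h0
  · exact absurd h0 hm.ne'
  · exact Or.inl (coe_injective K (τ.injective (by simp [h0])))
  · refine Or.inr (coe_injective K (τ.injective ?_))
    simp [h0.1]

/-- By Dirichlet's theorem a unit modulo squares is given by a sign and the parities of its
exponents. The clause `≠ 0` excludes infinite index, which `index` records as `0`. -/
theorem index_range_powMonoidHom_two_le (τ : K →+* ℝ) :
    (powMonoidHom 2 : (𝓞 K)ˣ →* (𝓞 K)ˣ).range.index ≤ 2 ^ (rank K + 1) ∧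
      (powMonoidHom 2 : (𝓞 K)ˣ →* (𝓞 K)ˣ).range.index ≠ 0 := by
  let S := (powMonoidHom 2 : (𝓞 K)ˣ →* (𝓞 K)ˣ).range
  let f : Bool × (Fin (rank K) → Fin 2) → (𝓞 K)ˣ ⧸ S := fun p ↦
    QuotientGroup.mk ((if p.1 then 1 else -1) * ∏ i, fundSystem K i ^ (p.2 i : ℕ))
  have hf : Function.Surjective f := by
    intro q
    obtain ⟨x, rfl⟩ := QuotientGroup.mk_surjective q
    obtain ⟨⟨ζ, e⟩, hx, -⟩ := exist_unique_eq_mul_prod K x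
    have hb : ∃ b : Bool, (if b then 1 else -1) = (ζ : (𝓞 K)ˣ) := by
      rcases eq_one_or_neg_one_of_mem_torsion K τ ζ.2 with h | h
      · exact ⟨true, by simp [h]⟩
      · exact ⟨false, by simp [h]⟩
    obtain ⟨b, hb⟩ := hb
    have he (i : Fin (rank K)) : (e i % 2).toNat < 2 := by omega
    refine ⟨(b, fun i ↦ ⟨(e i % 2).toNat, he i⟩), ?_⟩
    refine QuotientGroup.eq.2 ⟨∏ i, fundSystem K i ^ (e i / 2), ?_⟩
    have hx' : x = ζ * ∏ i, fundSystem K i ^ e i := hx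
    rw [powMonoidHom_apply, hb, hx', eq_inv_mul_iff_mul_eq, mul_assoc, ← Finset.prod_pow,
      ← Finset.prod_mul_distrib]
    congr 1
    refine Finset.prod_congr rfl fun i _ ↦ ?_
    rw [← zpow_natCast, ← zpow_natCast, ← zpow_mul, ← zpow_add]
    congr 1
    dsimp only
    omega
  have hfin : Finite ((𝓞 K)ˣ ⧸ S) := Finite.of_surjective f hf
  refine ⟨?_, Subgroup.index_ne_zero_of_finite⟩
  calc S.index ≤ Nat.card (Bool × (Fin (rank K) → Fin 2)) := Nat.card_le_card_of_surjective f hf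
    _ = 2 ^ (rank K + 1) := by simp [pow_succ, mul_comm]

theorem rank_add_one_le_card_realEmbeddings [IsTotallyReal K] :
    rank K + 1 ≤ Nat.card (K →+* ℝ) := by
  classical
  have h : rank K + 1 = Nat.card (InfinitePlace K) := by
    rw [rank, Nat.card_eq_fintype_card]
    exact Nat.sub_add_cancel Fintype.card_pos
  rw [h]
  refine Nat.card_le_card_of_injective
    (fun w : InfinitePlace K ↦ InfinitePlace.embedding_of_isReal (IsTotallyReal.isReal w)) ?_
  intro w w' hw
  ext x
  rw [← InfinitePlace.norm_embedding_of_isReal (IsTotallyReal.isReal w),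
    ← InfinitePlace.norm_embedding_of_isReal (IsTotallyReal.isReal w')]
  exact congrArg (fun τ : K →+* ℝ ↦ ‖τ x‖) hw

theorem nonempty_realEmbeddings [IsTotallyReal K] : Nonempty (K →+* ℝ) :=
  ⟨InfinitePlace.embedding_of_isReal
    (IsTotallyReal.isReal (Classical.arbitrary (InfinitePlace K)))⟩

/-- With `r` real embeddings, `[U : U²] ≤ 2 ^ r`, while `[U : U⁺]` is the order of the signature
image, at least `2 ^ r / 2`. Divide. -/
theorem relIndex_squares_ker_signature_le_two [IsTotallyReal K]
    (h : HasUnitsOfAlmostIndependentSigns K) :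
    (powMonoidHom 2 : (𝓞 K)ˣ →* (𝓞 K)ˣ).range.relIndex (signature K).ker ≤ 2 ∧
      (powMonoidHom 2 : (𝓞 K)ˣ →* (𝓞 K)ˣ).range.relIndex (signature K).ker ≠ 0 := by
  have hne := nonempty_realEmbeddings K
  obtain ⟨hle, h0⟩ := index_range_powMonoidHom_two_le K hne.some
  rw [← Subgroup.relIndex_mul_index (range_powMonoidHom_two_le_ker_signature K)] at hle h0
  refine ⟨?_, (mul_ne_zero_iff.1 h0).1⟩
  have hcard := Subgroup.card_mul_index (signature K).range
  rw [← Subgroup.index_ker, Nat.card_fun] at hcard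
  have hs : Nat.card SignTypeˣ = 2 := by rw [Nat.card_eq_fintype_card]; rfl
  rw [hs] at hcard
  have hr := index_range_signature_le_two K h
  have hpow : 2 ^ (rank K + 1) ≤ 2 ^ Nat.card (K →+* ℝ) :=
    Nat.pow_le_pow_right two_pos (rank_add_one_le_card_realEmbeddings K)
  have hpos : 0 < (signature K).ker.index := Nat.pos_of_ne_zero (mul_ne_zero_iff.1 h0).2
  have : (powMonoidHom 2 : (𝓞 K)ˣ →* (𝓞 K)ˣ).range.relIndex (signature K).ker *
      (signature K).ker.index ≤ 2 * (signature K).ker.index :=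
    calc _ ≤ 2 ^ Nat.card (K →+* ℝ) := hle.trans hpow
      _ = (signature K).ker.index * (signature K).range.index := hcard.symm
      _ ≤ (signature K).ker.index * 2 := Nat.mul_le_mul_left _ hr
      _ = _ := mul_comm _ _
  exact Nat.le_of_mul_le_mul_right this hpos

end NumberField.Units

/-! ### Norms of units from a CM-field. -/

namespace NumberField.IsCMField

variable (L : Type*) [Field L] [NumberField L] [IsCMField L]

/-- The units of the maximal real subfield that are of the form `v * conj v` for a unit `v`. -/
noncomputable def unitNorms : Subgroup (𝓞 (maximalRealSubfield L))ˣ :=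
  ((MonoidHom.id (𝓞 L)ˣ * (unitsComplexConj L).toMonoidHom).range).comap
    (Units.map (algebraMap (𝓞 (maximalRealSubfield L)) (𝓞 L)).toMonoidHom)

theorem mem_unitNorms (a : (𝓞 (maximalRealSubfield L))ˣ) :
    a ∈ unitNorms L ↔ ∃ v : (𝓞 L)ˣ, v * unitsComplexConj L v =
      Units.map (algebraMap (𝓞 (maximalRealSubfield L)) (𝓞 L)).toMonoidHom a := Iff.rfl

theorem unitsComplexConj_map (a : (𝓞 (maximalRealSubfield L))ˣ) :
    unitsComplexConj L (Units.map (algebraMap (𝓞 (maximalRealSubfield L)) (𝓞 L)).toMonoidHom a) =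
      Units.map (algebraMap (𝓞 (maximalRealSubfield L)) (𝓞 L)).toMonoidHom a :=
  (unitsComplexConj_eq_self_iff L _).2 ⟨a, rfl⟩

theorem coe_unitsComplexConj (a : (𝓞 L)ˣ) :
    ((unitsComplexConj L a : (𝓞 L)ˣ) : L) = complexConj L (a : L) := rfl

/-- All archimedean absolute values of `v` are one, so Kronecker's theorem applies. -/
theorem mem_torsion_of_mul_complexConj_eq_one {v : (𝓞 L)ˣ}
    (h : v * unitsComplexConj L v = 1) : v ∈ Units.torsion L := by
  refine (Units.mem_torsion L).2 fun w ↦ ?_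
  have h1 : (v : L) * complexConj L (v : L) = 1 := by
    rw [← coe_unitsComplexConj, ← Units.coe_mul, h, Units.coe_one]
  have h2 := congrArg w h1
  rw [map_mul, infinitePlace_complexConj, map_one, ← pow_two] at h2
  exact (pow_eq_one_iff_of_nonneg (apply_nonneg w _) two_ne_zero).1 h2

theorem range_powMonoidHom_two_le_unitNorms :
    (powMonoidHom 2 : _ →* (𝓞 (maximalRealSubfield L))ˣ).range ≤ unitNorms L := by
  rintro _ ⟨a, rfl⟩
  refine (mem_unitNorms L _).2 ⟨Units.map (algebraMap _ (𝓞 L)).toMonoidHom a, ?_⟩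
  rw [unitsComplexConj_map, powMonoidHom_apply, map_pow, pow_two]

/-- Under an extension `φ` of `τ` to `L`, the norm of `v` becomes `|φ v|²`. -/
theorem unitNorms_le_ker_signature :
    unitNorms L ≤ (Units.signature (maximalRealSubfield L)).ker := by
  intro a ha
  obtain ⟨v, hv⟩ := (mem_unitNorms L a).1 ha
  rw [Units.mem_ker_signature]
  intro τ
  let φ := ComplexEmbedding.lift L ((algebraMap ℝ ℂ).comp τ)
  have hφ : φ (algebraMap (maximalRealSubfield L) L (a : maximalRealSubfield L)) =
      (τ (a : maximalRealSubfield L) : ℂ) :=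
    RingHom.congr_fun (ComplexEmbedding.lift_comp_algebraMap L ((algebraMap ℝ ℂ).comp τ)) _
  have hv' : (v : L) * complexConj L (v : L) =
      algebraMap (maximalRealSubfield L) L (a : maximalRealSubfield L) := by
    rw [← coe_unitsComplexConj, ← Units.coe_mul, hv]
    rfl
  rw [← hv', map_mul, complexEmbedding_complexConj, Complex.mul_conj, Complex.ofReal_inj] at hφ
  rw [← hφ, Complex.normSq_pos]
  exact (map_ne_zero φ).2 (Units.coe_ne_zero v)

/-- If each `v * conj v` were a square `W²` with `W` real, then `W⁻¹ * v` would be a root of unity,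
and the unit index would be one. -/
theorem unitNorms_ne_squares (hQ : indexRealUnits L = 2) :
    ¬ unitNorms L ≤ (powMonoidHom 2 : _ →* (𝓞 (maximalRealSubfield L))ˣ).range := by
  intro hle
  have htop : realUnits L ⊔ Units.torsion L = ⊤ := by
    rw [Subgroup.eq_top_iff']
    intro v
    have hfix : unitsComplexConj L (v * unitsComplexConj L v) = v * unitsComplexConj L v := by
      refine Units.coe_injective L ?_
      change ((unitsComplexConj L (v * unitsComplexConj L v) : (𝓞 L)ˣ) : L) =
        ((v * unitsComplexConj L v : (𝓞 L)ˣ) : L)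
      rw [coe_unitsComplexConj, Units.coe_mul, map_mul, coe_unitsComplexConj,
        complexConj_apply_apply, mul_comm]
    obtain ⟨a, ha⟩ := (unitsComplexConj_eq_self_iff L _).1 hfix
    obtain ⟨w, hw⟩ := hle ((mem_unitNorms L a).2 ⟨v, ha.symm⟩)
    let W := Units.map (algebraMap (𝓞 (maximalRealSubfield L)) (𝓞 L)).toMonoidHom w
    have hW : v * unitsComplexConj L v = W * W := by
      rw [← ha, ← hw, powMonoidHom_apply, map_pow, pow_two]
    have ht : W⁻¹ * v ∈ Units.torsion L := by
      refine mem_torsion_of_mul_complexConj_eq_one L ?_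
      rw [map_mul, map_inv, unitsComplexConj_map, mul_mul_mul_comm, hW]
      change W⁻¹ * W⁻¹ * (W * W) = 1
      group
    have := Subgroup.mul_mem_sup (show W ∈ realUnits L from ⟨w, rfl⟩) ht
    rwa [mul_inv_cancel_left] at this
  rw [indexRealUnits, htop, Subgroup.index_top] at hQ
  exact absurd hQ (by norm_num)

/-- If the maximal real subfield has units of almost independent signs and the Hasse unit index is
two, then every totally positive unit is the relative norm of a unit. -/
theorem exists_mul_complexConj_eq_of_totallyPositive
    (hsigns : HasUnitsOfAlmostIndependentSigns (maximalRealSubfield L))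
    (hQ : indexRealUnits L = 2) (a : (𝓞 (maximalRealSubfield L))ˣ)
    (ha : ∀ τ : maximalRealSubfield L →+* ℝ, 0 < τ (a : maximalRealSubfield L)) :
    ∃ v : (𝓞 L)ˣ, v * unitsComplexConj L v =
      Units.map (algebraMap (𝓞 (maximalRealSubfield L)) (𝓞 L)).toMonoidHom a := by
  obtain ⟨h2, h0⟩ := Units.relIndex_squares_ker_signature_le_two _ hsigns
  -- In `U² ≤ N ≤ U⁺` the two indices are nonzero with product at most two. The lower one is not
  -- one, so the upper one is.
  rw [← Subgroup.relIndex_mul_relIndex _ _ _ (range_powMonoidHom_two_le_unitNorms L)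
    (unitNorms_le_ker_signature L)] at h2 h0
  have h1 := mt Subgroup.relIndex_eq_one.1 (unitNorms_ne_squares L hQ)
  obtain ⟨h3, h4⟩ := mul_ne_zero_iff.1 h0
  have h5 : (unitNorms L).relIndex (Units.signature (maximalRealSubfield L)).ker = 1 := by
    by_contra h6
    have := Nat.mul_le_mul (show 2 ≤ _ by omega) (show 2 ≤ _ by omega) |>.trans h2
    omega
  exact (mem_unitNorms L a).1
    (Subgroup.relIndex_eq_one.1 h5 ((Units.mem_ker_signature _ a).2 ha))

end NumberField.IsCMField

/-! ### CM-types and totally positive units. -/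

/-- A CM-type contains one of each pair of complex conjugate embeddings. -/
theorem IsCMType.mem_or_conjugate_mem {L : Type*} [Field L] [NumberField L] [IsCMField L]
    {Φ : Finset (L →+* ℂ)} (hΦ : IsCMType Φ) (φ : L →+* ℂ) :
    φ ∈ Φ ∨ ComplexEmbedding.conjugate φ ∈ Φ := by
  classical
  let c : (L →+* ℂ) ↪ (L →+* ℂ) :=
    ⟨ComplexEmbedding.conjugate, (ComplexEmbedding.involutive_conjugate L).injective⟩
  have hdisj : Disjoint Φ (Φ.map c) := by
    rw [Finset.disjoint_left]
    intro ψ h h'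
    obtain ⟨χ, hχ, rfl⟩ := Finset.mem_map.1 h'
    exact hΦ.2 χ hχ h
  -- `Φ` and its conjugate are disjoint with `n` elements each, and `L` has `2n` embeddings.
  have hcard : (Φ.disjUnion (Φ.map c) hdisj).card = Fintype.card (L →+* ℂ) := by
    rw [Finset.card_disjUnion, Finset.card_map, hΦ.1, Embeddings.card,
      ← Module.finrank_mul_finrank ℚ (maximalRealSubfield L) L,
      Algebra.IsQuadraticExtension.finrank_eq_two (maximalRealSubfield L) L, mul_two]
  have hmem : φ ∈ Φ.disjUnion (Φ.map c) hdisj := by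
    rw [(Finset.card_eq_iff_eq_univ _).1 hcard]
    exact Finset.mem_univ _
  rcases Finset.mem_disjUnion.1 hmem with h | h
  · exact Or.inl h
  · obtain ⟨χ, hχ, rfl⟩ := Finset.mem_map.1 h
    refine Or.inr ?_
    rwa [show ComplexEmbedding.conjugate (c χ) = χ from ComplexEmbedding.involutive_conjugate L χ]

/-- A unit of a CM-field which is real and positive under the embeddings of a CM-type is the
relative norm of a unit. -/
theorem IsCMType.exists_unit_mul_complexConj_eq {L : Type*} [Field L] [NumberField L]
    [IsCMField L] {Φ : Finset (L →+* ℂ)} (hΦ : IsCMType Φ)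
    (hsigns : HasUnitsOfAlmostIndependentSigns (maximalRealSubfield L))
    (hQ : IsCMField.indexRealUnits L = 2) (u : (𝓞 L)ˣ) (hreal : ∀ φ ∈ Φ, (φ (u : L)).im = 0)
    (hpos : ∀ φ ∈ Φ, 0 < (φ (u : L)).re) :
    ∃ v : (𝓞 L)ˣ, v * IsCMField.unitsComplexConj L v = u := by
  have hall (φ : L →+* ℂ) : (φ (u : L)).im = 0 ∧ 0 < (φ (u : L)).re := by
    rcases hΦ.mem_or_conjugate_mem φ with h | h
    · exact ⟨hreal φ h, hpos φ h⟩
    · have h1 := hreal _ h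
      have h2 := hpos _ h
      rw [ComplexEmbedding.conjugate_coe_eq, Complex.conj_im, neg_eq_zero] at h1
      rw [ComplexEmbedding.conjugate_coe_eq, Complex.conj_re] at h2
      exact ⟨h1, h2⟩
  have hfix : IsCMField.unitsComplexConj L u = u := by
    obtain ⟨φ⟩ : Nonempty (L →+* ℂ) := inferInstance
    refine Units.coe_injective L (φ.injective ?_)
    change φ ((IsCMField.unitsComplexConj L u : (𝓞 L)ˣ) : L) = φ (u : L)
    rw [IsCMField.coe_unitsComplexConj, IsCMField.complexEmbedding_complexConj]
    exact Complex.conj_eq_iff_im.2 (hall φ).1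
  obtain ⟨a, ha⟩ := (IsCMField.unitsComplexConj_eq_self_iff L u).1 hfix
  obtain ⟨v, hv⟩ := IsCMField.exists_mul_complexConj_eq_of_totallyPositive L hsigns hQ a fun τ ↦ by
    let φ := ComplexEmbedding.lift L ((algebraMap ℝ ℂ).comp τ)
    have hφ : φ (u : L) = (τ (a : maximalRealSubfield L) : ℂ) := by
      rw [← ha]
      exact RingHom.congr_fun
        (ComplexEmbedding.lift_comp_algebraMap L ((algebraMap ℝ ℂ).comp τ)) _
    have := (hall φ).2
    rwa [hφ, Complex.ofReal_re] at this
  exact ⟨v, hv.trans ha⟩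

/-! ### Lattices and Riemann forms. -/

namespace ComplexTorus

variable {A : ComplexTorus.{u}}

theorem finrank_lattice (A : ComplexTorus.{u}) :
    Module.finrank ℤ A.Λ = Module.finrank ℝ A.V ∧ Module.Finite ℤ A.Λ ∧
      Submodule.span ℝ (A.Λ : Set A.V) = ⊤ := by
  obtain ⟨b, hb⟩ := A.isLattice
  rw [← hb]
  refine ⟨?_, ?_, ?_⟩
  · rw [Module.finrank_eq_card_basis (b.restrictScalars ℤ), Fintype.card_fin]
  · exact Module.Finite.of_basis (b.restrictScalars ℤ)
  · rw [Submodule.span_span_of_tower, b.span_eq]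

namespace Polarization

variable (E : A.Polarization)

theorem form_swap (x y : A.V) : E.form x y = -E.form y x := by
  have h := E.alternating (x + y)
  simp only [map_add, LinearMap.add_apply, E.alternating, zero_add, add_zero] at h
  linarith

theorem form_I_smul_left (x y : A.V) :
    E.form (Complex.I • x) y = -E.form x (Complex.I • y) := by
  rw [E.form_swap, E.symmetric]

/-- A complex line is a real plane, where an alternating form is determined by one number. This
turns identities on an eigenvector into identities of complex numbers. -/
theorem form_smul_smul (c d : ℂ) (x : A.V) :
    E.form (c • x) (d • x) = (starRingEnd ℂ c * d).im * E.form x (Complex.I • x) := by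
  have h (c : ℂ) : c • x = c.re • x + c.im • (Complex.I • x) := by
    rw [← Complex.coe_smul, ← Complex.coe_smul, smul_smul, ← add_smul, Complex.re_add_im]
  rw [h c, h d]
  simp only [map_add, map_smul, LinearMap.add_apply, LinearMap.smul_apply, E.alternating,
    E.form_swap (Complex.I • x) x, smul_eq_mul, Complex.mul_im, Complex.conj_re, Complex.conj_im]
  ring

theorem eq_zero_of_form_eq_zero {x : A.V} (h : ∀ y, E.form x y = 0) : x = 0 := by
  by_contra hx
  exact (E.positive x hx).ne' (h _)

variable {E}

/-- For a principal polarization `E`, every integral form `F` satisfying `F (i x) y = -F x (i y)`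
is of the form `E (T x) y` for an endomorphism `T`. -/
theorem IsPrincipal.exists_endRing (hE : E.IsPrincipal) (F : A.V →ₗ[ℝ] A.V →ₗ[ℝ] ℝ)
    (hint : ∀ x ∈ A.Λ, ∀ y ∈ A.Λ, ∃ k : ℤ, F x y = k)
    (hI : ∀ x y, F (Complex.I • x) y = -F x (Complex.I • y)) :
    ∃ T ∈ A.endRing, ∀ x y, E.form (T x) y = F x y := by
  have hfin : FiniteDimensional ℝ A.V := FiniteDimensional.complexToReal A.V
  have hinj : Function.Injective E.form := by
    refine (injective_iff_map_eq_zero E.form).2 fun x hx ↦ E.eq_zero_of_form_eq_zero fun y ↦ ?_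
    rw [hx, LinearMap.zero_apply]
  -- Positivity makes `E` nondegenerate, so `T` is `E⁻¹ ∘ F`. The condition on `i` makes it complex
  -- linear, and self-duality of `Λ` makes it preserve the lattice.
  let e : A.V ≃ₗ[ℝ] (A.V →ₗ[ℝ] ℝ) :=
    LinearMap.linearEquivOfInjective E.form hinj (Subspace.dual_finrank_eq).symm
  let S : A.V →ₗ[ℝ] A.V := e.symm.toLinearMap ∘ₗ F
  have hS (x y : A.V) : E.form (S x) y = F x y :=
    LinearMap.congr_fun (e.apply_symm_apply (F x)) y
  have hSI (x : A.V) : S (Complex.I • x) = Complex.I • S x := by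
    refine hinj (LinearMap.ext fun y ↦ ?_)
    rw [hS, hI, ← hS, E.form_I_smul_left]
  let T : Module.End ℂ A.V :=
    { toFun := S
      map_add' := S.map_add
      map_smul' := fun c x ↦ by
        have h (c : ℂ) (z : A.V) : c • z = c.re • z + c.im • (Complex.I • z) := by
          rw [← Complex.coe_smul, ← Complex.coe_smul, smul_smul, ← add_smul, Complex.re_add_im]
        rw [RingHom.id_apply, h c x, h c (S x), map_add, map_smul, map_smul, hSI] }
  refine ⟨T, fun x hx ↦ hE _ fun y hy ↦ ?_, hS⟩
  obtain ⟨k, hk⟩ := hint x hx y hy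
  exact ⟨k, (hS x y).trans hk⟩

/-- Pulling back a polarization along an isomorphism of complex tori. -/
def pullback {B : ComplexTorus.{v}} (F : B.Polarization) (T : A.V ≃ₗ[ℂ] B.V)
    (hT : ∀ x, T x ∈ B.Λ ↔ x ∈ A.Λ) : A.Polarization where
  form := F.form.compl₁₂ (T.toLinearMap.restrictScalars ℝ) (T.toLinearMap.restrictScalars ℝ)
  alternating x := F.alternating (T x)
  integral x hx y hy := F.integral _ ((hT x).2 hx) _ ((hT y).2 hy)
  symmetric x y := by
    have := F.symmetric (T x) (T y)
    rwa [← map_smul, ← map_smul] at this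
  positive x hx := by
    have := F.positive (T x) (T.map_ne_zero_iff.2 hx)
    rwa [← map_smul] at this

theorem IsPrincipal.pullback {B : ComplexTorus.{v}} {F : B.Polarization} (hF : F.IsPrincipal)
    (T : A.V ≃ₗ[ℂ] B.V) (hT : ∀ x, T x ∈ B.Λ ↔ x ∈ A.Λ) : (F.pullback T hT).IsPrincipal := by
  intro x hx
  refine (hT x).1 (hF _ fun y hy ↦ ?_)
  obtain ⟨z, rfl⟩ := T.surjective y
  exact hx z ((hT z).1 hy)

theorem IsIsomorphic.of_pullback {B : ComplexTorus.{v}} {F : B.Polarization}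
    (T : A.V ≃ₗ[ℂ] B.V) (hT : ∀ x, T x ∈ B.Λ ↔ x ∈ A.Λ)
    (h : E.IsIsomorphic (F.pullback T hT)) : E.IsIsomorphic F := by
  obtain ⟨S, hS, hSF⟩ := h
  exact ⟨S.trans T, fun x ↦ (hT _).trans (hS x), hSF⟩

end Polarization

/-! ### Endomorphisms of a torus with complex multiplication. -/

variable {L : Type w} [Field L] [NumberField L]

/-- If `A` has type `(𝓞 L, Φ)`, then its endomorphisms are the images of the elements of `𝓞 L`. -/
theorem IsOfIntegralCMType.exists_basis {Φ : Finset (L →+* ℂ)} (h : A.IsOfIntegralCMType Φ) :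
    ∃ (ι : L →+* Module.End ℂ A.V) (b : Module.Basis Φ ℂ A.V),
      (∀ (x : L) (φ : Φ), ι x (b φ) = (φ : L →+* ℂ) x • b φ) ∧
        ∀ T : Module.End ℂ A.V, T ∈ A.endRing ↔ ∃ y : 𝓞 L, ι (y : L) = T := by
  obtain ⟨⟨ι₀, b, hb⟩, ⟨f⟩⟩ := h
  let ι : L →+* Module.End ℂ A.V := A.endAlgebra.subtype.comp ι₀
  have hι (x : L) : ∃ m : ℕ, m ≠ 0 ∧ m • ι x ∈ A.endRing := (ι₀ x).2
  let g (T : A.endRing) : L := (f T : L)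
  have hg_nsmul (m : ℕ) (T : A.endRing) : g (m • T) = m * g T := by
    simp only [g, nsmul_eq_mul, map_mul, map_natCast]
  choose m hm0 hm using hι
  -- The isomorphism `f` is not assumed compatible with `ι`. Clearing denominators and applying `f`
  -- compares them by a map `σ` from `L` to itself, independent of the multiple chosen by `hσ`. It
  -- is an automorphism, so it preserves integrality in both directions.
  let σ₀ (x : L) : L := g ⟨m x • ι x, hm x⟩ / m x
  have hσ (x : L) (k : ℕ) (hk0 : k ≠ 0) (hk : k • ι x ∈ A.endRing) :
      (k : L) * σ₀ x = g ⟨k • ι x, hk⟩ := by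
    have h1 : m x • (⟨k • ι x, hk⟩ : A.endRing) = k • ⟨m x • ι x, hm x⟩ :=
      Subtype.ext (smul_comm (m x) k (ι x))
    have h2 := congrArg g h1
    rw [hg_nsmul, hg_nsmul] at h2
    have h3 : (m x : L) ≠ 0 := Nat.cast_ne_zero.2 (hm0 x)
    simp only [σ₀]
    field_simp
    rw [← h2]
  let σ : L →+* L :=
    { toFun := σ₀
      map_one' := by
        have h1 : (1 : ℕ) • ι 1 ∈ A.endRing := by
          rw [one_smul, map_one]
          exact A.endRing.one_mem
        have := hσ 1 1 one_ne_zero h1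
        rw [Nat.cast_one, one_mul] at this
        rw [this, show (⟨(1 : ℕ) • ι 1, h1⟩ : A.endRing) = 1 from Subtype.ext (by simp)]
        simp [g]
      map_mul' := fun x y ↦ by
        have h1 : (m x * m y) • ι (x * y) = (m x • ι x) * (m y • ι y) := by
          rw [map_mul, smul_mul_smul_comm]
        have h2 := hσ (x * y) (m x * m y) (mul_ne_zero (hm0 x) (hm0 y))
          (h1 ▸ A.endRing.mul_mem (hm x) (hm y))
        have h3 : g ⟨(m x * m y) • ι (x * y), h1 ▸ A.endRing.mul_mem (hm x) (hm y)⟩ =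
            g ⟨m x • ι x, hm x⟩ * g ⟨m y • ι y, hm y⟩ := by
          simp only [g, ← map_mul]
          congr 2
          exact Subtype.ext h1
        rw [h3, ← hσ x _ (hm0 x), ← hσ y _ (hm0 y), Nat.cast_mul] at h2
        have h4 : (m x : L) ≠ 0 := Nat.cast_ne_zero.2 (hm0 x)
        have h5 : (m y : L) ≠ 0 := Nat.cast_ne_zero.2 (hm0 y)
        refine mul_left_cancel₀ (mul_ne_zero h4 h5) (h2.trans ?_)
        ring
      map_zero' := by
        have h1 : (1 : ℕ) • ι 0 ∈ A.endRing := by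
          rw [one_smul, map_zero]
          exact A.endRing.zero_mem
        have := hσ 0 1 one_ne_zero h1
        rw [Nat.cast_one, one_mul] at this
        rw [this, show (⟨(1 : ℕ) • ι 0, h1⟩ : A.endRing) = 0 from Subtype.ext (by simp)]
        simp [g]
      map_add' := fun x y ↦ by
        have h1 : (m x * m y) • ι (x + y) = m y • (m x • ι x) + m x • (m y • ι y) := by
          rw [map_add, smul_add, smul_smul, smul_smul, mul_comm (m x)]
        have h1' := h1 ▸ A.endRing.add_mem (A.endRing.nsmul_mem (hm x) (m y))
          (A.endRing.nsmul_mem (hm y) (m x))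
        have h2 := hσ (x + y) (m x * m y) (mul_ne_zero (hm0 x) (hm0 y)) h1'
        have h3 : g ⟨(m x * m y) • ι (x + y), h1'⟩ =
            m y * g ⟨m x • ι x, hm x⟩ + m x * g ⟨m y • ι y, hm y⟩ := by
          rw [← hg_nsmul, ← hg_nsmul]
          simp only [g, ← map_add]
          congr 2
          exact Subtype.ext h1
        rw [h3, ← hσ x _ (hm0 x), ← hσ y _ (hm0 y), Nat.cast_mul] at h2
        have h4 : (m x : L) ≠ 0 := Nat.cast_ne_zero.2 (hm0 x)
        have h5 : (m y : L) ≠ 0 := Nat.cast_ne_zero.2 (hm0 y)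
        refine mul_left_cancel₀ (mul_ne_zero h4 h5) (h2.trans ?_)
        ring }
  have hσbij : Function.Bijective σ := by
    have := Algebra.IsAlgebraic.algHom_bijective (σ.toRatAlgHom)
    exact this
  let τ : L ≃+* L := RingEquiv.ofBijective σ hσbij
  have key (y : L) (T : A.endRing) (hyT : σ y = g T) : ι y = T := by
    have h1 : m y • (⟨m y • ι y, hm y⟩ : A.endRing) = m y • (m y • T) := by
      refine f.injective (RingOfIntegers.ext ?_)
      change g _ = g _
      rw [hg_nsmul, hg_nsmul, hg_nsmul, ← hσ y _ (hm0 y), ← hyT]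
      rfl
    have h2 : m y • m y • ι y = m y • m y • (T : Module.End ℂ A.V) := congrArg Subtype.val h1
    simp only [← Nat.cast_smul_eq_nsmul ℂ] at h2
    have h3 : (m y : ℂ) ≠ 0 := Nat.cast_ne_zero.2 (hm0 y)
    exact smul_right_injective _ h3 (smul_right_injective _ h3 h2)
  refine ⟨ι, b, hb, fun T ↦ ⟨fun hT ↦ ?_, ?_⟩⟩
  · let y := τ.symm (g ⟨T, hT⟩)
    have hy : IsIntegral ℤ y := 
      (RingOfIntegers.isIntegral_coe (f ⟨T, hT⟩)).map τ.symm.toRingHom.toIntAlgHom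
    exact ⟨⟨y, hy⟩, key y ⟨T, hT⟩ (τ.apply_symm_apply _)⟩
  · rintro ⟨y, rfl⟩
    have hy : IsIntegral ℤ (σ y) := (RingOfIntegers.isIntegral_coe y).map σ.toIntAlgHom
    have := key y (f.symm ⟨σ y, hy⟩) 
      (congrArg (fun z : 𝓞 L ↦ (z : L)) (f.apply_symm_apply ⟨σ y, hy⟩)).symm
    rw [this]
    exact (f.symm ⟨σ y, hy⟩).2

/-! ### The Rosati involution, uniqueness on one torus, and the lattice. -/

section CM

variable {Φ : Finset (L →+* ℂ)} {ι : L →+* Module.End ℂ A.V} {b : Module.Basis Φ ℂ A.V}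

/-- Pairing with `x` compares imaginary parts, pairing with `i x` real parts. -/
theorem eq_conj_of_form_eq (E : A.Polarization) {x : A.V} (hx : x ≠ 0) {c d : ℂ}
    (h : E.form x (c • x) = E.form (d • x) x)
    (h' : E.form x (c • Complex.I • x) = E.form (d • x) (Complex.I • x)) :
    d = starRingEnd ℂ c := by
  have hpos := (E.positive x hx).ne'
  have h1 := E.form_smul_smul 1 c x
  have h2 := E.form_smul_smul d 1 x
  have h3 := E.form_smul_smul 1 (c * Complex.I) x
  have h4 := E.form_smul_smul d Complex.I x
  rw [one_smul] at h1 h2 h3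
  rw [mul_smul] at h3
  rw [h1, h2] at h
  rw [h3, h4] at h'
  have h5 := mul_right_cancel₀ hpos h
  have h6 := mul_right_cancel₀ hpos h'
  simp at h5 h6
  refine Complex.ext ?_ ?_
  · rw [Complex.conj_re, h6]
  · rw [Complex.conj_im, h5, neg_neg]

variable [IsCMField L]

/-- The Rosati involution of a principal polarization is the complex conjugation. -/
theorem Polarization.IsPrincipal.form_apply_right {E : A.Polarization} (hE : E.IsPrincipal)
    (hΦ : IsCMType Φ)
    (hb : ∀ (x : L) (φ : Φ), ι x (b φ) = (φ : L →+* ℂ) x • b φ)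
    (hι : ∀ T : Module.End ℂ A.V, T ∈ A.endRing ↔ ∃ y : 𝓞 L, ι (y : L) = T)
    (y : 𝓞 L) (v w : A.V) :
    E.form v (ι (y : L) w) = E.form (ι (IsCMField.complexConj L (y : L)) v) w := by
  have hy : ι (y : L) ∈ A.endRing := (hι _).2 ⟨y, rfl⟩
  -- The adjoint of `ι y` lies in `End(A)`, so it is `ι y'` with `y'` in `𝓞 L`. One eigenvector then
  -- determines `y'`, as `φ` is injective.
  obtain ⟨T, hT, hTE⟩ := hE.exists_endRing
    (E.form.compl₁₂ LinearMap.id ((ι (y : L)).restrictScalars ℝ))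
    (fun x hx z hz ↦ E.integral x hx _ (hy z hz))
    (fun x z ↦ by
      simp only [LinearMap.compl₁₂_apply, LinearMap.id_apply, LinearMap.restrictScalars_apply,
        map_smul, E.form_I_smul_left])
  obtain ⟨y', rfl⟩ := (hι T).1 hT
  have hTE' (x z : A.V) : E.form (ι (y' : L) x) z = E.form x (ι (y : L) z) := hTE x z
  rw [← hTE']
  have hpos : 0 < Φ.card := hΦ.1 ▸ Module.finrank_pos
  obtain ⟨φ, hφ⟩ := Finset.card_pos.1 hpos
  have h1 := hTE' (b ⟨φ, hφ⟩) (b ⟨φ, hφ⟩)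
  have h2 := hTE' (b ⟨φ, hφ⟩) (Complex.I • b ⟨φ, hφ⟩)
  rw [(ι (y : L)).map_smul] at h2
  rw [hb, hb] at h1 h2
  rw [smul_comm] at h2
  have h3 := eq_conj_of_form_eq E (b.ne_zero _) h1.symm h2.symm
  rw [← IsCMField.complexEmbedding_complexConj] at h3
  rw [φ.injective h3]

/-- A complex torus with complex multiplication by `𝓞 L` has at most one principal polarization up
to isomorphism if `L` satisfies the unit conditions. -/
theorem IsOfIntegralCMType.isIsomorphic
    (hsigns : HasUnitsOfAlmostIndependentSigns (maximalRealSubfield L))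
    (hQ : IsCMField.indexRealUnits L = 2) (hΦ : IsCMType Φ) (hA : A.IsOfIntegralCMType Φ)
    {E E' : A.Polarization} (hE : E.IsPrincipal) (hE' : E'.IsPrincipal) : E.IsIsomorphic E' := by
  obtain ⟨ι, b, hb, hι⟩ := hA.exists_basis
  have hιinj : Function.Injective ι := by
    have hpos : 0 < Φ.card := hΦ.1 ▸ Module.finrank_pos
    obtain ⟨φ, hφ⟩ := Finset.card_pos.1 hpos
    intro x y hxy
    have := hb x ⟨φ, hφ⟩
    rw [hxy, hb] at this
    exact φ.injective (smul_left_injective ℂ (b.ne_zero _) this).symm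
  obtain ⟨T, hT, hTE⟩ := hE.exists_endRing E'.form E'.integral E'.form_I_smul_left
  obtain ⟨T', hT', hTE'⟩ := hE'.exists_endRing E.form E.integral E.form_I_smul_left
  obtain ⟨u, rfl⟩ := (hι T).1 hT
  obtain ⟨u', rfl⟩ := (hι T').1 hT'
  have huu' : u * u' = 1 := by
    refine RingOfIntegers.ext (hιinj (LinearMap.ext fun x ↦ sub_eq_zero.1 ?_))
    refine E.eq_zero_of_form_eq_zero fun y ↦ ?_
    have h1 : ι ((u * u' : 𝓞 L) : L) x = ι (u : L) (ι (u' : L) x) :=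
      LinearMap.congr_fun (map_mul (ι.comp (algebraMap (𝓞 L) L)) u u') x
    have h2 : ι ((1 : 𝓞 L) : L) x = x :=
      LinearMap.congr_fun (map_one (ι.comp (algebraMap (𝓞 L) L))) x
    rw [h1, h2, map_sub, LinearMap.sub_apply, hTE, hTE', sub_self]
  let U : (𝓞 L)ˣ := ⟨u, u', huu', by rw [mul_comm, huu']⟩
  -- Taking `d = 1` gives reality of `φ u`, and `d = i` gives positivity.
  have hform (φ : Φ) (d : ℂ) : E'.form (b φ) (d • b φ) =
      (starRingEnd ℂ ((φ : L →+* ℂ) (u : L)) * d).im * E.form (b φ) (Complex.I • b φ) := by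
    rw [← hTE, hb, E.form_smul_smul]
  have hreal : ∀ φ ∈ Φ, (φ (U : L)).im = 0 := fun φ hφ ↦ by
    have := hform ⟨φ, hφ⟩ 1
    rw [one_smul, E'.alternating, mul_one, Complex.conj_im] at this
    have h := (mul_eq_zero.1 this.symm).resolve_right (E.positive _ (b.ne_zero _)).ne'
    exact neg_eq_zero.1 h
  have hpos : ∀ φ ∈ Φ, 0 < (φ (U : L)).re := fun φ hφ ↦ by
    have := E'.positive (b ⟨φ, hφ⟩) (b.ne_zero _)
    rw [hform, Complex.mul_I_im, Complex.conj_re] at this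
    exact pos_of_mul_pos_left this (E.positive _ (b.ne_zero _)).le
  obtain ⟨v, hv⟩ := hΦ.exists_unit_mul_complexConj_eq hsigns hQ U hreal hpos
  have hv' : (u : L) = IsCMField.complexConj L (v : L) * (v : L) := by
    rw [← IsCMField.coe_unitsComplexConj, ← Units.coe_mul, mul_comm, hv]
  have hpull (x y : A.V) : E.form (ι (v : L) x) (ι (v : L) y) = E'.form x y := by
    rw [hE.form_apply_right hΦ hb hι (v : 𝓞 L), ← Module.End.mul_apply, ← map_mul, ← hv', hTE]
  have hvv : (v : L) * ((v⁻¹ : (𝓞 L)ˣ) : L) = 1 := by rw [← Units.coe_mul, mul_inv_cancel]; simp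
  have h1 (x : A.V) : ι (v : L) (ι ((v⁻¹ : (𝓞 L)ˣ) : L) x) = x := by
    rw [← Module.End.mul_apply, ← map_mul, hvv, map_one, Module.End.one_apply]
  have h2 (x : A.V) : ι ((v⁻¹ : (𝓞 L)ˣ) : L) (ι (v : L) x) = x := by
    rw [← Module.End.mul_apply, ← map_mul, mul_comm, hvv, map_one, Module.End.one_apply]
  have hmem (a : (𝓞 L)ˣ) : ι (a : L) ∈ A.endRing := (hι _).2 ⟨a, rfl⟩
  -- As `v` pulls `E` back to `E'`, the required map is its inverse.
  refine ⟨LinearEquiv.ofLinearMap (ι ((v⁻¹ : (𝓞 L)ˣ) : L)) (ι (v : L)) (LinearMap.ext h2)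
    (LinearMap.ext h1), fun x ↦ ⟨fun h ↦ ?_, fun h ↦ hmem v⁻¹ x h⟩, fun x y ↦ ?_⟩
  · have := hmem v _ h
    rwa [LinearEquiv.coe_ofLinearMap, h1] at this
  · rw [← hpull, LinearEquiv.coe_ofLinearMap, h1, h1]

/-- If `L` has class number one, the lattice of a complex torus with complex multiplication by
`𝓞 L` is the image of `𝓞 L` under the embeddings of the CM-type, in suitable coordinates. -/
theorem IsOfIntegralCMType.exists_basis_lattice (hL : classNumber L = 1) (hΦ : IsCMType Φ)
    (hA : A.IsOfIntegralCMType Φ) :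
    ∃ b : Module.Basis Φ ℂ A.V, ∀ x : A.V,
      x ∈ A.Λ ↔ ∃ y : 𝓞 L, ∑ φ : Φ, (φ : L →+* ℂ) (y : L) • b φ = x := by
  obtain ⟨ι, b, hb, hι⟩ := hA.exists_basis
  have hpid : IsPrincipalIdealRing (𝓞 L) := classNumber_eq_one_iff.1 hL
  obtain ⟨hrank, hfin, hspan⟩ := A.finrank_lattice
  have hmem (y : 𝓞 L) : ι (y : L) ∈ A.endRing := (hι _).2 ⟨y, rfl⟩
  let κ : 𝓞 L →+* Module.End ℂ A.V := ι.comp (algebraMap (𝓞 L) L)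
  let : Module (𝓞 L) A.Λ :=
    { smul := fun y x ↦ ⟨κ y x, hmem y x x.2⟩
      one_smul := fun x ↦ Subtype.ext (LinearMap.congr_fun (map_one κ) (x : A.V))
      mul_smul := fun y z x ↦ Subtype.ext (LinearMap.congr_fun (map_mul κ y z) (x : A.V))
      smul_zero := fun y ↦ Subtype.ext (map_zero (κ y))
      smul_add := fun y x x' ↦ Subtype.ext (map_add (κ y) (x : A.V) x')
      add_smul := fun y z x ↦ Subtype.ext (LinearMap.congr_fun (map_add κ y z) (x : A.V))
      zero_smul := fun x ↦ Subtype.ext (LinearMap.congr_fun (map_zero κ) (x : A.V)) }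
  have htors : Module.IsTorsionFree (𝓞 L) A.Λ := by
    refine Module.IsTorsionFree.of_smul_eq_zero fun y x h ↦ ?_
    by_contra! hne
    have h1 : ι (y : L) (x : A.V) = 0 := congrArg Subtype.val h
    have h2 : (y : L) ≠ 0 := RingOfIntegers.coe_ne_zero_iff.2 hne.1
    have h3 := congrArg (ι (y : L)⁻¹) h1
    rw [← Module.End.mul_apply, ← map_mul, inv_mul_cancel₀ h2, map_one, map_zero] at h3
    exact hne.2 (Subtype.ext h3)
  have htower : IsScalarTower ℤ (𝓞 L) A.Λ := AddCommGroup.intIsScalarTower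
  have hfin' : Module.Finite (𝓞 L) A.Λ := Module.Finite.of_restrictScalars_finite ℤ (𝓞 L) A.Λ
  have hfree : Module.Free (𝓞 L) A.Λ := Module.free_of_finite_type_torsion_free'
  -- Both `Λ` and `𝓞 L` have rank `2n` over `ℤ`.
  have hone : Module.finrank (𝓞 L) A.Λ = 1 := by
    have h1 := Module.finrank_mul_finrank ℤ (𝓞 L) A.Λ
    rw [hrank, finrank_real_of_complex, Module.finrank_eq_card_basis b, Fintype.card_coe,
      RingOfIntegers.rank, hΦ.1, ← Module.finrank_mul_finrank ℚ (maximalRealSubfield L) L,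
      Algebra.IsQuadraticExtension.finrank_eq_two (maximalRealSubfield L) L, mul_comm 2] at h1
    refine mul_left_cancel₀ ?_ (h1.trans (mul_one _).symm)
    exact mul_ne_zero Module.finrank_pos.ne' two_ne_zero
  obtain ⟨v, hv⟩ := finrank_eq_one_iff'.1 hone
  have hmemv (x : A.V) : x ∈ A.Λ ↔ ∃ y : 𝓞 L, ι (y : L) v = x := by
    refine ⟨fun hx ↦ ?_, ?_⟩
    · obtain ⟨y, hy⟩ := hv.2 ⟨x, hx⟩
      exact ⟨y, congrArg Subtype.val hy⟩
    · rintro ⟨y, rfl⟩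
      exact hmem y v v.2
  have hcoord (x : L) (w : A.V) (φ : Φ) : b.repr (ι x w) φ = (φ : L →+* ℂ) x * b.repr w φ := by
    classical
    have : b.coord φ ∘ₗ ι x = (φ : L →+* ℂ) x • b.coord φ := by
      refine b.ext fun ψ ↦ ?_
      rw [LinearMap.comp_apply, hb, map_smul, LinearMap.smul_apply, b.coord_apply, b.repr_self,
        Finsupp.single_apply]
      split_ifs with h
      · rw [h]
      · rw [smul_zero, smul_zero]
    exact LinearMap.congr_fun this w
  -- If a coordinate of the generator `v` vanished, `Λ` would lie in a complex hyperplane and could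
  -- not span `V`.
  have hne (φ : Φ) : b.repr v φ ≠ 0 := by
    intro h0
    have hle : Submodule.span ℝ (A.Λ : Set A.V) ≤
        (LinearMap.ker (b.coord φ)).restrictScalars ℝ := by
      refine Submodule.span_le.2 fun x hx ↦ ?_
      obtain ⟨y, rfl⟩ := (hmemv x).1 hx
      change b.repr (ι (y : L) v) φ = 0
      rw [hcoord, h0, mul_zero]
    rw [hspan] at hle
    have h1 : b.coord φ (b φ) = 0 := hle (Submodule.mem_top (x := b φ))
    rw [b.coord_apply, b.repr_self, Finsupp.single_eq_same] at h1
    exact one_ne_zero h1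
  -- Rescaling by the coordinates of `v` makes `v` the sum of the basis vectors.
  refine ⟨b.isUnitSMul fun φ ↦ (hne φ).isUnit, fun x ↦ (hmemv x).trans (exists_congr fun y ↦ ?_)⟩
  have hsum : ∑ φ : Φ, (φ : L →+* ℂ) (y : L) • b.isUnitSMul (fun φ ↦ (hne φ).isUnit) φ =
      ι (y : L) v := by
    rw [← b.sum_repr (ι (y : L) v)]
    refine Finset.sum_congr rfl fun φ _ ↦ ?_
    rw [Module.Basis.isUnitSMul_apply, smul_smul, hcoord]
  rw [hsum]

end CM

end ComplexTorus

theorem mainTheorem4 (L : Type w) [Field L] [NumberField L] [NumberField.IsCMField L]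
    (hsigns : HasUnitsOfAlmostIndependentSigns (NumberField.maximalRealSubfield L))
    (hQ : NumberField.IsCMField.indexRealUnits L = 2)
    (Φ : Finset (L →+* ℂ)) (hΦ : IsCMType Φ) (hsimple : IsSimpleCMType Φ) :
    (∀ A : ComplexTorus.{u}, A.IsOfIntegralCMType Φ →
      ∀ E E' : A.Polarization, E.IsPrincipal → E'.IsPrincipal → E.IsIsomorphic E') ∧
    (NumberField.classNumber L = 1 →
      ∀ (A : ComplexTorus.{u}) (B : ComplexTorus.{v}),
        A.IsOfIntegralCMType Φ → B.IsOfIntegralCMType Φ →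
        ∀ (E : A.Polarization) (F : B.Polarization),
          E.IsPrincipal → F.IsPrincipal → E.IsIsomorphic F) := by
  refine ⟨fun A hA E E' hE hE' ↦ hA.isIsomorphic hsigns hQ hΦ hE hE',
    fun hL A B hA hB E F hE hF ↦ ?_⟩
  obtain ⟨a, ha⟩ := hA.exists_basis_lattice hL hΦ
  obtain ⟨b, hb⟩ := hB.exists_basis_lattice hL hΦ
  -- Both lattices have the same coordinates, so matching the bases is an isomorphism of tori.
  have hT (x : A.V) : a.equiv b (Equiv.refl _) x ∈ B.Λ ↔ x ∈ A.Λ := by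
    rw [ha, hb]
    refine exists_congr fun y ↦ ?_
    rw [← (a.equiv b (Equiv.refl _)).injective.eq_iff (a := ∑ φ : Φ, _), map_sum]
    simp only [map_smul, Module.Basis.equiv_apply, Equiv.refl_apply]
  exact (hA.isIsomorphic hsigns hQ hΦ hE (hF.pullback _ hT)).of_pullback
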